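/- Consider the following subgroups of $GL_2(\mathbb{C})$: $$G_I=\left\langle \tfrac{1}{\sqrt2}\begin{pmatrix}1&1\\1&-1\end{pmatrix},\begin{pmatrix}1&0\\0&-1\end{pmatrix}\right\rangle,\qquad G_{II}=\left\langle \tfrac{1}{\sqrt2}\begin{pmatrix}1&1\\1&-1\end{pmatrix},\begin{pmatrix}1&0\\0&i\end{pmatrix}\right\rangle,$$ $$G_{III}=\left\langle \tfrac{1}{\sqrt3}\begin{pmatrix}1&2\\1&-1\end{pmatrix},\begin{pmatrix}1&0\\0&e^{2\pi i/3}\end{pmatrix}\right\rangle,\qquad G_{IV}=\left\langle \tfrac12\begin{pmatrix}1&3\\1&-1\end{pmatrix},\begin{pmatrix}1&0\\0&-1\end{pmatrix}\right\rangle.$$ For a subgroup $G$ of $GL_2(\mathbb{C})$ let $\mathbb{C}[x,y]^{G}$ be the ring of all $f\in\mathbb{C}[x,y]$ with $f(\sigma\bar x)=f(\bar x)$ for every $\sigma\in G$, where $\bar x=(x,y)^{T}$. For finite $G$ and $k\ge 0$ let $$\varphi_k=\varphi_k^{G}=\frac1{|G|}\sum_{\sigma\in G}(\sigma_1\bar x)^k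 ,$$ where $\sigma_1$ is the first row of $\sigma$ (the E-polynomial of degree $k$ of $G$). Then the four groups above are finite, and $$\mathbb{C}[x,y]^{G_I}=\mathbb{C}[\varphi_2,\varphi_8],\quad \mathbb{C}[x,y]^{G_{II}}=\mathbb{C}[\varphi_8,\varphi_{24}],\quad \mathbb{C}[x,y]^{G_{III}}=\mathbb{C}[\varphi_4,\varphi_{12}],\quad \mathbb{C}[x,y]^{G_{IV}}=\mathbb{C}[\varphi_2,\varphi_6],$$ where in each case the $\varphi_k$ are those of the group in question and the two generators are algebraically independent over $\mathbb{C}$, so that each invariant ring is a polynomial ring in them. -/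

import Mathlib

open MvPolynomial

namespace EPolynomial

noncomputable section

/-- The matrix $\frac{1}{\sqrt 2}\begin{pmatrix}1&1\\1&-1\end{pmatrix}$. -/
def matA2 : Matrix (Fin 2) (Fin 2) ℂ :=
  ((Real.sqrt 2 : ℝ) : ℂ)⁻¹ • !![1, 1; 1, -1]

/-- The matrix $\frac{1}{\sqrt 3}\begin{pmatrix}1&2\\1&-1\end{pmatrix}$. -/
def matA3 : Matrix (Fin 2) (Fin 2) ℂ :=
  ((Real.sqrt 3 : ℝ) : ℂ)⁻¹ • !![1, 2; 1, -1]

/-- The matrix $\frac{1}{2}\begin{pmatrix}1&3\\1&-1\end{pmatrix}$. -/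
def matA4 : Matrix (Fin 2) (Fin 2) ℂ :=
  (2 : ℂ)⁻¹ • !![1, 3; 1, -1]

/-- The diagonal matrix $\mathrm{diag}(1, z)$. -/
def matB (z : ℂ) : Matrix (Fin 2) (Fin 2) ℂ := !![1, 0; 0, z]

theorem det_matA2_ne_zero : matA2.det ≠ 0 := by
  have h : ((Real.sqrt 2 : ℝ) : ℂ) ≠ 0 := by
    rw [Complex.ofReal_ne_zero]; positivity
  rw [matA2, Matrix.det_smul, Matrix.det_fin_two_of]
  exact mul_ne_zero (pow_ne_zero _ (inv_ne_zero h)) (by norm_num)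

theorem det_matA3_ne_zero : matA3.det ≠ 0 := by
  have h : ((Real.sqrt 3 : ℝ) : ℂ) ≠ 0 := by
    rw [Complex.ofReal_ne_zero]; positivity
  rw [matA3, Matrix.det_smul, Matrix.det_fin_two_of]
  exact mul_ne_zero (pow_ne_zero _ (inv_ne_zero h)) (by norm_num)

theorem det_matA4_ne_zero : matA4.det ≠ 0 := by
  rw [matA4, Matrix.det_smul, Matrix.det_fin_two_of]
  exact mul_ne_zero (pow_ne_zero _ (inv_ne_zero two_ne_zero)) (by norm_num)

theorem det_matB_ne_zero {z : ℂ} (hz : z ≠ 0) : (matB z).det ≠ 0 := by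
  rw [matB, Matrix.det_fin_two_of]
  simpa using hz

/-- The group $G_I$. -/
def GI : Subgroup (GL (Fin 2) ℂ) :=
  Subgroup.closure
    {Matrix.GeneralLinearGroup.mkOfDetNeZero matA2 det_matA2_ne_zero,
     Matrix.GeneralLinearGroup.mkOfDetNeZero (matB (-1))
      (det_matB_ne_zero (neg_ne_zero.mpr one_ne_zero))}

/-- The group $G_{II}$. -/
def GII : Subgroup (GL (Fin 2) ℂ) :=
  Subgroup.closure
    {Matrix.GeneralLinearGroup.mkOfDetNeZero matA2 det_matA2_ne_zero,
     Matrix.GeneralLinearGroup.mkOfDetNeZero (matB Complex.I)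
      (det_matB_ne_zero Complex.I_ne_zero)}

/-- The group $G_{III}$. -/
def GIII : Subgroup (GL (Fin 2) ℂ) :=
  Subgroup.closure
    {Matrix.GeneralLinearGroup.mkOfDetNeZero matA3 det_matA3_ne_zero,
     Matrix.GeneralLinearGroup.mkOfDetNeZero (matB (Complex.exp (2 * Real.pi * Complex.I / 3)))
      (det_matB_ne_zero (Complex.exp_ne_zero _))}

/-- The group $G_{IV}$. -/
def GIV : Subgroup (GL (Fin 2) ℂ) :=
  Subgroup.closure
    {Matrix.GeneralLinearGroup.mkOfDetNeZero matA4 det_matA4_ne_zero,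
     Matrix.GeneralLinearGroup.mkOfDetNeZero (matB (-1))
      (det_matB_ne_zero (neg_ne_zero.mpr one_ne_zero))}

/-- The linear form $\sigma_i \bar x$: the `i`-th row of `σ` times the column vector of the
variables `X 0` ($= x$) and `X 1` ($= y$). -/
def rowForm (σ : GL (Fin 2) ℂ) (i : Fin 2) : MvPolynomial (Fin 2) ℂ :=
  ∑ j : Fin 2, C ((σ : Matrix (Fin 2) (Fin 2) ℂ) i j) * X j

/-- The substitution $f^\sigma(\bar x) = f(\sigma \bar x)$ of `σ` in polynomials. -/
def act (σ : GL (Fin 2) ℂ) : MvPolynomial (Fin 2) ℂ →ₐ[ℂ] MvPolynomial (Fin 2) ℂ :=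
  aeval (rowForm σ)

/-- The invariant ring $\mathbb{C}[x,y]^G$. -/
def invariantRing (G : Subgroup (GL (Fin 2) ℂ)) : Subalgebra ℂ (MvPolynomial (Fin 2) ℂ) where
  carrier := {f | ∀ σ ∈ G, act σ f = f}
  mul_mem' ha hb σ hσ := by rw [map_mul, ha σ hσ, hb σ hσ]
  add_mem' ha hb σ hσ := by rw [map_add, ha σ hσ, hb σ hσ]
  algebraMap_mem' r σ _ := (act σ).commutes r

/-- The E-polynomial $\varphi_k = \frac{1}{|G|}\sum_{\sigma\in G}(\sigma_1\bar x)^k$ of a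
finite group `G`, where $\sigma_1$ is the first row of $\sigma$. -/
def ePoly (G : Subgroup (GL (Fin 2) ℂ)) (k : ℕ) : MvPolynomial (Fin 2) ℂ :=
  C ((Nat.card G : ℂ)⁻¹) * ∑ᶠ σ : G, rowForm (σ : GL (Fin 2) ℂ) 0 ^ k

end

end EPolynomial

namespace EPolynomial

/-! Suppose G contains the scalars of order d, has dk elements that are distinct modulo scalars, and
has invariant forms f, g of degrees d and dk. These elements carry a generic point p to dk different
lines. A combination g' = g - c f^k vanishes at p, hence on all these lines, and its degree leaves
no room for other zeros. Because of the scalars, a nonzero invariant form has degree dm for some m.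
After subtraction of a multiple of f^m it vanishes at p too, so g' divides it and the quotient is an
invariant of smaller degree. This descent gives generation (`invariantRing_eq_adjoin`); restricting
relations to the line through p gives independence (`algebraicIndependent_of_eval`).

The E-polynomials become explicit through the orbit of the row (1, 0). Modulo d-th roots of unity it
is a short list of rows w_i, so φ_n is the mean of the (w_i · x)^n whenever d divides n
(`ePoly_eq`). Elements taking (1, 0) to the w_i, multiplied by powers of diag(1, z), supply the dk
elements. What remains for each group is the list w and the fact that φ_{dk} is not a multiple of
φ_d^k, seen from the values at two points. -/

/-! ### Binary forms and the lines on which they vanish -/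

theorem aeval_mul_of_isHomogeneous {σ R S : Type*} [Fintype σ] [CommSemiring R] [CommSemiring S]
    [Algebra R S] {f : MvPolynomial σ R} {n : ℕ} (hf : f.IsHomogeneous n) (s : S) (g : σ → S) :
    aeval (fun i => s * g i) f = s ^ n * aeval g f := by
  rw [aeval_def, aeval_def, eval₂_eq', eval₂_eq', Finset.mul_sum]
  refine Finset.sum_congr rfl fun d hd => ?_
  have h : n = ∑ i, d i := by
    rw [hf.degree_eq_sum_deg_support hd]
    exact Finsupp.degree_eq_sum d
  simp_rw [mul_pow, Finset.prod_mul_distrib, Finset.prod_pow_eq_pow_sum, h]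
  ring

theorem aeval_sub_aeval_mem {σ R S : Type*} [CommRing R] [CommRing S]
    [Algebra R S] (f : MvPolynomial σ R) {g h : σ → S} {I : Ideal S}
    (hgh : ∀ i, g i - h i ∈ I) : aeval g f - aeval h f ∈ I := by
  rw [← Ideal.Quotient.eq]
  have key : ∀ u : σ → S, Ideal.Quotient.mk I (aeval u f)
      = aeval (fun i => Ideal.Quotient.mk I (u i)) f := fun u =>
    DFunLike.congr_fun (comp_aeval u (Ideal.Quotient.mkₐ R I)) f
  rw [key, key]
  congr 2
  funext i
  exact Ideal.Quotient.eq.mpr (hgh i)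

/-- The linear form vanishing on the line spanned by `p`. -/
noncomputable def lineForm (p : Fin 2 → ℂ) : MvPolynomial (Fin 2) ℂ :=
  C (p 1) * X 0 - C (p 0) * X 1

theorem isHomogeneous_lineForm (p : Fin 2 → ℂ) : (lineForm p).IsHomogeneous 1 :=
  (isHomogeneous_C_mul_X _ _).sub (isHomogeneous_C_mul_X _ _)

theorem eval_lineForm (p q : Fin 2 → ℂ) : eval q (lineForm p) = p 1 * q 0 - p 0 * q 1 := by
  simp [lineForm]

/-- Modulo `lineForm p` the vectors p_i X and X_i p agree, so p_i^n f(X) = f(p_i X) ≡ X_i^n f(p) =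
0. Choosing i with p_i ≠ 0 makes p_i^n a unit. -/
theorem lineForm_dvd {f : MvPolynomial (Fin 2) ℂ} {n : ℕ} (hf : f.IsHomogeneous n)
    {p : Fin 2 → ℂ} (hp : p ≠ 0) (h : eval p f = 0) : lineForm p ∣ f := by
  have aux : ∀ i : Fin 2, p i ≠ 0 →
      (∀ k, C (p i) * X k - X i * C (p k) ∈ Ideal.span {lineForm p}) → lineForm p ∣ f := by
    intro i hi hk
    have h1 := aeval_sub_aeval_mem (R := ℂ) f hk
    have h2 : aeval (fun k => (C (p k) : MvPolynomial (Fin 2) ℂ)) f = C (eval p f) :=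
      (aeval_algebraMap_apply (MvPolynomial (Fin 2) ℂ) p f).trans
        (by simp [algebraMap_eq, aeval_eq_eval])
    rw [aeval_mul_of_isHomogeneous hf, aeval_mul_of_isHomogeneous hf, h2, h, C_0, mul_zero,
      sub_zero, aeval_X_left_apply, Ideal.mem_span_singleton] at h1
    refine (IsUnit.dvd_mul_left ?_).mp h1
    exact ((IsUnit.mk0 _ hi).map C).pow n
  have hmem : C (p 1) * X 0 - C (p 0) * X 1 ∈ Ideal.span {lineForm p} :=
    Ideal.subset_span rfl
  by_cases h0 : p 0 = 0
  · have h1 : p 1 ≠ 0 := fun h1 => hp (by funext i; fin_cases i <;> assumption)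
    refine aux 1 h1 (Fin.forall_fin_two.mpr ⟨?_, ?_⟩)
    · convert hmem using 1; ring
    · convert Ideal.zero_mem _ using 1; ring
  · refine aux 0 h0 (Fin.forall_fin_two.mpr ⟨?_, ?_⟩)
    · convert Ideal.zero_mem _ using 1; ring
    · convert neg_mem hmem using 1; ring

/-- The component of `a * b` in degree i + deg b is `a` times the top component of `b`; cancelling
`a` shows that `b` is its own top component. -/
theorem exists_isHomogeneous_of_mul {σ R : Type*} [CommRing R] [IsDomain R]
    {a b : MvPolynomial σ R} {i n : ℕ} (ha : a.IsHomogeneous i) (hab : (a * b).IsHomogeneous n)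
    (h : a * b ≠ 0) : ∃ k, n = i + k ∧ b.IsHomogeneous k := by
  let _ := gradedAlgebra (σ := σ) (R := R)
  have ha0 := left_ne_zero_of_mul h
  have hb0 := right_ne_zero_of_mul h
  have hn : n = i + b.totalDegree := by
    rw [← hab.totalDegree h, totalDegree_mul_of_isDomain ha0 hb0, ha.totalDegree ha0]
  refine ⟨_, hn, ?_⟩
  have key := DirectSum.coe_decompose_mul_add_of_left_mem (homogeneousSubmodule σ R)
    (j := b.totalDegree) (b := b) ha
  rw [DirectSum.decompose_of_mem_same (homogeneousSubmodule σ R) (x := a * b) (hn ▸ hab)] at key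
  have hmem := (DirectSum.decompose (homogeneousSubmodule σ R) b b.totalDegree).2
  rwa [← mul_left_cancel₀ ha0 key] at hmem

theorem prod_lineForm_dvd {ι : Type*} (s : Finset ι) {p : ι → Fin 2 → ℂ}
    (hp : ∀ i ∈ s, p i ≠ 0)
    (hpq : ∀ i ∈ s, ∀ j ∈ s, i ≠ j → eval (p j) (lineForm (p i)) ≠ 0)
    {n : ℕ} {f : MvPolynomial (Fin 2) ℂ} (hf : f.IsHomogeneous n)
    (h : ∀ i ∈ s, eval (p i) f = 0) : ∏ i ∈ s, lineForm (p i) ∣ f := by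
  classical
  by_cases hf0 : f = 0
  · rw [hf0]; exact dvd_zero _
  induction s using Finset.induction_on generalizing n f with
  | empty => simp
  | insert a s ha ih =>
    obtain ⟨g, rfl⟩ := lineForm_dvd hf (hp a (by simp)) (h a (by simp))
    obtain ⟨k, -, hg⟩ := exists_isHomogeneous_of_mul (isHomogeneous_lineForm _) hf hf0
    rw [Finset.prod_insert ha]
    refine mul_dvd_mul_left _ (ih (fun i hi => hp i (by simp [hi]))
      (fun i hi j hj => hpq i (by simp [hi]) j (by simp [hj])) hg ?_ (right_ne_zero_of_mul hf0))
    intro i hi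
    have h1 := h i (by simp [hi])
    rw [map_mul] at h1
    exact (mul_eq_zero.mp h1).resolve_left
      (hpq a (by simp) i (by simp [hi]) (by rintro rfl; exact ha hi))

/-- A nonzero homogeneous form of degree `n` vanishing on `n` distinct lines divides every
homogeneous form vanishing on these lines. -/
theorem dvd_of_eval_eq_zero {ι : Type*} [Fintype ι] {p : ι → Fin 2 → ℂ}
    (hp : ∀ i, p i ≠ 0) (hpq : ∀ i j, i ≠ j → eval (p j) (lineForm (p i)) ≠ 0)
    {n : ℕ} {f g : MvPolynomial (Fin 2) ℂ} (hf : f.IsHomogeneous n)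
    (hg : g.IsHomogeneous (Fintype.card ι)) (hg0 : g ≠ 0)
    (hfp : ∀ i, eval (p i) f = 0) (hgp : ∀ i, eval (p i) g = 0) : g ∣ f := by
  obtain ⟨a, rfl⟩ := prod_lineForm_dvd Finset.univ (fun i _ => hp i) (fun i _ j _ => hpq i j) hg
    (fun i _ => hgp i)
  have h1 : (∏ i, lineForm (p i)).IsHomogeneous (Fintype.card ι) := by
    simpa using IsHomogeneous.prod Finset.univ (fun i => lineForm (p i)) (fun _ => 1)
      (fun i _ => isHomogeneous_lineForm _)
  -- The product of line forms already has the degree of `g`, so the cofactor is a nonzero constant.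
  obtain ⟨k, hk, ha⟩ := exists_isHomogeneous_of_mul h1 hg hg0
  obtain rfl : k = 0 := by omega
  have ha' : a = C (coeff 0 a) := by
    rw [← homogeneousComponent_zero, homogeneousComponent_eq_self ha]
  have hu : IsUnit a := by
    rw [ha']
    refine (IsUnit.mk0 _ fun h => right_ne_zero_of_mul hg0 ?_).map C
    rw [ha', h, C_0]
  rw [hu.mul_right_dvd]
  exact prod_lineForm_dvd Finset.univ (fun i _ => hp i) (fun i _ j _ => hpq i j) hf
    (fun i _ => hfp i)

/-- On the line through p a relation P(f, g) = 0 becomes P(t^d f(p), 0) = 0, and t^d f(p) takes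
every complex value. Hence P(X, 0) = 0 and the second variable divides P; cancelling g gives a
relation of smaller degree. -/
theorem algebraicIndependent_of_eval {d : ℕ} (hd : d ≠ 0) {f g : MvPolynomial (Fin 2) ℂ}
    (hf : f.IsHomogeneous d) {n : ℕ} (hg : g.IsHomogeneous n) (hg0 : g ≠ 0)
    {p : Fin 2 → ℂ} (hfp : eval p f ≠ 0) (hgp : eval p g = 0) :
    AlgebraicIndependent ℂ ![f, g] := by
  rw [algebraicIndependent_iff]
  intro P
  induction hN : P.totalDegree using Nat.strong_induction_on generalizing P with
  | _ N ih =>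
  intro hP
  by_contra hP0
  have hP1 : aeval ![X 0, 0] P = (0 : MvPolynomial (Fin 2) ℂ) := by
    refine MvPolynomial.funext fun x => ?_
    obtain ⟨t, ht⟩ := IsAlgClosed.exists_pow_nat_eq (x 0 / eval p f) (Nat.pos_of_ne_zero hd)
    have h1 := congrArg (eval fun i => t * p i) hP
    have hh : ∀ (u : MvPolynomial (Fin 2) ℂ) (m : ℕ), u.IsHomogeneous m →
        eval (fun i => t * p i) u = t ^ m * eval p u := fun u m hu => by
      simpa [aeval_eq_eval] using aeval_mul_of_isHomogeneous (S := ℂ) hu t p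
    have h2 : ∀ (y : Fin 2 → ℂ) (u : Fin 2 → MvPolynomial (Fin 2) ℂ),
        eval y (aeval u P) = eval (fun i => eval y (u i)) P := fun y u => by
      rw [← aeval_eq_eval, ← aeval_eq_eval]
      exact DFunLike.congr_fun (comp_aeval u (aeval y : MvPolynomial (Fin 2) ℂ →ₐ[ℂ] ℂ)) P
    rw [h2, map_zero] at h1
    rw [h2, map_zero, ← h1]
    congr 2
    funext i
    fin_cases i
    · simp [hh _ _ hf, ht, hfp]
    · simp [hh _ _ hg, hgp]
  obtain ⟨Q, rfl⟩ : X 1 ∣ P := by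
    rw [← Ideal.mem_span_singleton]
    have := aeval_sub_aeval_mem (R := ℂ) P (g := X) (h := ![X 0, 0])
      (I := Ideal.span {(X 1 : MvPolynomial (Fin 2) ℂ)})
      (Fin.forall_fin_two.mpr ⟨by simp, by simp⟩)
    rwa [hP1, sub_zero, aeval_X_left_apply] at this
  have hQ0 := right_ne_zero_of_mul hP0
  rw [map_mul, aeval_X] at hP
  refine hQ0 (ih Q.totalDegree ?_ Q rfl ((mul_eq_zero.mp hP).resolve_left hg0))
  rw [← hN, totalDegree_mul_of_isDomain (X_ne_zero _) hQ0, totalDegree_X]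
  omega

/-! ### The action on forms, and generic points -/

theorem eval_rowForm (σ : GL (Fin 2) ℂ) (i : Fin 2) (x : Fin 2 → ℂ) :
    eval x (rowForm σ i) = (σ.val.mulVec x) i := by
  simp [rowForm, Matrix.mulVec, dotProduct]

theorem eval_act (σ : GL (Fin 2) ℂ) (f : MvPolynomial (Fin 2) ℂ) (x : Fin 2 → ℂ) :
    eval x (act σ f) = eval (σ.val.mulVec x) f := by
  have h := DFunLike.congr_fun
    (comp_aeval (R := ℂ) (rowForm σ) (aeval x : MvPolynomial (Fin 2) ℂ →ₐ[ℂ] ℂ)) f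
  rw [← aeval_eq_eval, ← aeval_eq_eval]
  refine h.trans ?_
  congr 2
  funext i
  exact (aeval_eq_eval x ▸ eval_rowForm σ i x)

theorem isHomogeneous_rowForm (σ : GL (Fin 2) ℂ) (i : Fin 2) : (rowForm σ i).IsHomogeneous 1 :=
  IsHomogeneous.sum _ _ _ fun _ _ => isHomogeneous_C_mul_X _ _

theorem isHomogeneous_act (σ : GL (Fin 2) ℂ) {f : MvPolynomial (Fin 2) ℂ} {n : ℕ}
    (hf : f.IsHomogeneous n) : (act σ f).IsHomogeneous n := by
  have h := hf.aeval (rowForm σ) (isHomogeneous_rowForm σ)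
  rwa [one_mul] at h

theorem homogeneousComponent_act (σ : GL (Fin 2) ℂ) (f : MvPolynomial (Fin 2) ℂ) (n : ℕ) :
    homogeneousComponent n (act σ f) = act σ (homogeneousComponent n f) := by
  conv_lhs => rw [← sum_homogeneousComponent f]
  rw [map_sum, map_sum]
  simp_rw [homogeneousComponent_of_mem
    (isHomogeneous_act σ (homogeneousComponent_isHomogeneous _ f))]
  rw [Finset.sum_ite_eq]
  split_ifs with h
  · rfl
  · rw [homogeneousComponent_eq_zero n f (by simpa using h), map_zero]

theorem act_eq_smul {σ : GL (Fin 2) ℂ} {ζ : ℂ} (hσ : σ.val = ζ • 1)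
    {f : MvPolynomial (Fin 2) ℂ} {n : ℕ} (hf : f.IsHomogeneous n) :
    act σ f = C (ζ ^ n) * f := by
  refine MvPolynomial.funext fun x => ?_
  have h := aeval_mul_of_isHomogeneous (S := ℂ) hf ζ x
  rw [aeval_eq_eval, aeval_eq_eval] at h
  rw [eval_act, hσ, map_mul, eval_C]
  refine Eq.trans ?_ h
  congr 2
  funext i
  simp [Matrix.smul_mulVec]

/-- Every vector is an eigenvector of τ⁻¹σ, which is therefore scalar; e₁, e₂ and e₁ + e₂ suffice as
tests. -/
theorem eq_smul_of_forall_eval_lineForm {σ τ : GL (Fin 2) ℂ}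
    (h : ∀ x, eval (τ.val.mulVec x) (lineForm (σ.val.mulVec x)) = 0) :
    ∃ c : ℂ, σ.val = c • τ.val := by
  have h0 := h ![1, 0]
  have h1 := h ![0, 1]
  have h2 := h ![1, 1]
  have hD : τ.val.det ≠ 0 := (Matrix.isUnit_iff_isUnit_det _).mp τ.isUnit |>.ne_zero
  rw [Matrix.det_fin_two] at hD
  simp only [eval_lineForm, Matrix.mulVec, dotProduct, Fin.sum_univ_two, Matrix.cons_val_zero,
    Matrix.cons_val_one, mul_one, mul_zero, add_zero, zero_add] at h0 h1 h2
  -- The upper left entry of τ⁻¹σ.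
  refine ⟨(σ.val 0 0 * τ.val 1 1 - σ.val 1 0 * τ.val 0 1) /
    (τ.val 0 0 * τ.val 1 1 - τ.val 0 1 * τ.val 1 0), ?_⟩
  ext i j
  rw [Matrix.smul_apply, smul_eq_mul, div_mul_eq_mul_div, eq_div_iff hD]
  fin_cases i <;> fin_cases j <;> simp only [Fin.zero_eta, Fin.mk_one, Fin.isValue]
  · linear_combination (τ.val 0 1) * h0
  · linear_combination (τ.val 0 1) * (h2 - h0 - h1) - (τ.val 0 0) * h1
  · linear_combination (τ.val 1 1) * h0
  · linear_combination (τ.val 1 1) * (h2 - h0 - h1) - (τ.val 1 0) * h1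

theorem exists_generic_point {f : MvPolynomial (Fin 2) ℂ} (hf : f ≠ 0) {ι : Type*} [Fintype ι]
    {ρ : ι → GL (Fin 2) ℂ} (hρ : ∀ i j, i ≠ j → ∀ c : ℂ, (ρ i).val ≠ c • (ρ j).val) :
    ∃ p, eval p f ≠ 0 ∧ ∀ i j, i ≠ j →
      eval ((ρ j).val.mulVec p) (lineForm ((ρ i).val.mulVec p)) ≠ 0 := by
  classical
  -- `D (i, j)` is the determinant of the columns ρ_i x and ρ_j x, up to sign; the value 1 on the
  -- diagonal keeps the product over all pairs nonzero.
  let D : ι × ι → MvPolynomial (Fin 2) ℂ := fun a => if a.1 = a.2 then 1 else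
    rowForm (ρ a.1) 1 * rowForm (ρ a.2) 0 - rowForm (ρ a.1) 0 * rowForm (ρ a.2) 1
  have hD : ∀ i j, i ≠ j → ∀ x, eval x (D (i, j)) =
      eval ((ρ j).val.mulVec x) (lineForm ((ρ i).val.mulVec x)) := fun i j hij x => by
    simp [D, hij, eval_rowForm, eval_lineForm]
  have hD0 : ∀ a, D a ≠ 0 := by
    rintro ⟨i, j⟩ h
    by_cases hij : i = j
    · simp [D, hij] at h
    · obtain ⟨c, hc⟩ := eq_smul_of_forall_eval_lineForm (σ := ρ i) (τ := ρ j)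
        fun x => by rw [← hD i j hij, h, map_zero]
      exact hρ i j hij c hc
  have hF : f * ∏ a, D a ≠ 0 := mul_ne_zero hf (Finset.prod_ne_zero_iff.mpr fun a _ => hD0 a)
  obtain ⟨p, hp⟩ : ∃ p, eval p (f * ∏ a, D a) ≠ 0 := by
    by_contra! h
    exact hF (MvPolynomial.funext fun x => by rw [h x, map_zero])
  rw [map_mul, map_prod] at hp
  refine ⟨p, left_ne_zero_of_mul hp, fun i j hij => ?_⟩
  rw [← hD i j hij]
  exact Finset.prod_ne_zero_iff.mp (right_ne_zero_of_mul hp) (i, j) (Finset.mem_univ _)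

/-! ### Generation by two invariants -/

theorem mem_of_forall_isHomogeneous {G : Subgroup (GL (Fin 2) ℂ)}
    {S : Subalgebra ℂ (MvPolynomial (Fin 2) ℂ)}
    (h : ∀ n, ∀ f ∈ invariantRing G, f.IsHomogeneous n → f ∈ S) : invariantRing G ≤ S := by
  intro f hf
  rw [← sum_homogeneousComponent f]
  refine sum_mem fun n _ => h n _ (fun σ hσ => ?_) (homogeneousComponent_isHomogeneous n f)
  rw [← homogeneousComponent_act, hf σ hσ]

theorem C_mul_mem {S : Subalgebra ℂ (MvPolynomial (Fin 2) ℂ)} (c : ℂ)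
    {f : MvPolynomial (Fin 2) ℂ} (hf : f ∈ S) : C c * f ∈ S := by
  rw [C_mul']
  exact S.smul_mem hf c

/-- The substitution Y ↦ Y + c X^k is an automorphism of ℂ[X, Y], with inverse Y ↦ Y - c X^k. -/
theorem algebraicIndependent_add_C_mul_pow {f g : MvPolynomial (Fin 2) ℂ} (c : ℂ) (k : ℕ)
    (h : AlgebraicIndependent ℂ ![f, g - C c * f ^ k]) : AlgebraicIndependent ℂ ![f, g] := by
  rw [algebraicIndependent_iff] at h ⊢
  intro P hP
  have hc : ∀ (S : Type) [CommRing S] [Algebra ℂ S] (u : Fin 2 → MvPolynomial (Fin 2) ℂ)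
      (v : Fin 2 → S), aeval v (aeval u P) = aeval (fun i => aeval v (u i)) P := fun S _ _ u v =>
    DFunLike.congr_fun (comp_aeval u (aeval v : MvPolynomial (Fin 2) ℂ →ₐ[ℂ] S)) P
  have h1 := h (aeval ![X 0, X 1 + C c * X 0 ^ k] P) (by
    rw [hc, ← hP]
    congr 2
    funext i
    fin_cases i <;> simp [algebraMap_eq])
  have h2 := congrArg (aeval ![X 0, X 1 - C c * X 0 ^ k] :
    MvPolynomial (Fin 2) ℂ →ₐ[ℂ] MvPolynomial (Fin 2) ℂ) h1
  rw [hc, map_zero] at h2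
  rw [← h2]
  conv_lhs => rw [← aeval_X_left_apply P]
  congr 2
  funext i
  fin_cases i <;> simp [algebraMap_eq]

/-- Invariants `f`, `g` of degrees `d` and `d * k` generate the invariant ring if the group
contains the scalars of order `d` and has `d * k` elements that are distinct modulo scalars. -/
theorem invariantRing_eq_adjoin {G : Subgroup (GL (Fin 2) ℂ)} {d : ℕ} (hd : d ≠ 0) {ζ : ℂ}
    (hζ : IsPrimitiveRoot ζ d) {s : GL (Fin 2) ℂ} (hs : s ∈ G) (hsζ : s.val = ζ • 1) {k : ℕ}
    (hk : k ≠ 0) {f g : MvPolynomial (Fin 2) ℂ} (hf : f.IsHomogeneous d)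
    (hg : g.IsHomogeneous (d * k)) (hfG : f ∈ invariantRing G) (hgG : g ∈ invariantRing G)
    (hf0 : f ≠ 0) (hfg : ∀ c, g ≠ C c * f ^ k) {ι : Type*} [Fintype ι]
    (hι : Fintype.card ι = d * k) {ρ : ι → GL (Fin 2) ℂ} (hρG : ∀ i, ρ i ∈ G)
    (hρ : ∀ i j, i ≠ j → ∀ c : ℂ, (ρ i).val ≠ c • (ρ j).val) :
    invariantRing G = Algebra.adjoin ℂ {f, g} ∧ AlgebraicIndependent ℂ ![f, g] := by
  obtain ⟨p, hfp, hp⟩ := exists_generic_point hf0 hρ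
  set A := Algebra.adjoin ℂ {f, g} with hA
  have hfA : f ∈ A := Algebra.subset_adjoin (by simp)
  have hgA : g ∈ A := Algebra.subset_adjoin (by simp)
  have hAG : A ≤ invariantRing G := Algebra.adjoin_le (by rintro x (rfl | rfl) <;> assumption)
  have horb : ∀ h ∈ invariantRing G, ∀ i, eval ((ρ i).val.mulVec p) h = eval p h :=
    fun h hh i => by rw [← eval_act, hh _ (hρG i)]
  -- A form of positive degree vanishes at the origin, but f takes the value f(p) ≠ 0 on the orbit.
  have hp0 : ∀ i, (ρ i).val.mulVec p ≠ 0 := fun i h0 => by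
    have h1 := aeval_mul_of_isHomogeneous (S := ℂ) hf 0 0
    rw [aeval_eq_eval, zero_pow hd, zero_mul] at h1
    apply hfp
    rw [← horb f hfG i, h0, ← h1]
    congr 2
    funext i
    simp
  set c := eval p g / eval p f ^ k with hc
  set g' := g - C c * f ^ k with hg'
  have hg'hom : g'.IsHomogeneous (d * k) := hg.sub ((hf.pow k).C_mul c)
  have hg'A : g' ∈ A := sub_mem hgA (C_mul_mem c (pow_mem hfA k))
  have hg'0 : g' ≠ 0 := sub_ne_zero.mpr (hfg c)
  have hg'p : eval p g' = 0 := by simp [hg', hc, hfp]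
  refine ⟨le_antisymm (mem_of_forall_isHomogeneous fun n => ?_) hAG,
    algebraicIndependent_add_C_mul_pow c k
      (algebraicIndependent_of_eval hd hf hg'hom hg'0 hfp hg'p)⟩
  induction n using Nat.strong_induction_on with
  | _ n ih =>
  intro h hh hhom
  by_cases h0 : h = 0
  · rw [h0]; exact zero_mem A
  -- The scalar ζ multiplies a form of degree n by ζ^n, and h ≠ 0 is fixed.
  obtain ⟨m, rfl⟩ : d ∣ n := by
    rw [← hζ.pow_eq_one_iff_dvd]
    have h1 := act_eq_smul hsζ hhom
    rw [hh s hs] at h1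
    have h2 : C (ζ ^ n) = (1 : MvPolynomial (Fin 2) ℂ) :=
      mul_right_cancel₀ h0 (by rw [← h1, one_mul])
    exact C_injective _ _ (by rw [h2, C_1])
  set e := eval p h / eval p f ^ m with he
  have hfm : C e * f ^ m ∈ A := C_mul_mem e (pow_mem hfA m)
  suffices hsub : h - C e * f ^ m ∈ A by simpa using add_mem hsub hfm
  have hhom' : (h - C e * f ^ m).IsHomogeneous (d * m) := hhom.sub ((hf.pow m).C_mul e)
  have hG' : h - C e * f ^ m ∈ invariantRing G := sub_mem hh (hAG hfm)
  obtain ⟨q, hq⟩ := dvd_of_eval_eq_zero hp0 hp hhom' (hι ▸ hg'hom) hg'0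
    (fun i => by rw [horb _ hG']; simp [he, hfp])
    (fun i => by rw [horb _ (hAG hg'A), hg'p])
  rw [hq] at hG' hhom' ⊢
  by_cases hq0 : g' * q = 0
  · rw [hq0]; exact zero_mem A
  obtain ⟨j, hj, hqj⟩ := exists_isHomogeneous_of_mul hg'hom hhom' hq0
  refine mul_mem hg'A (ih j ?_ q (fun σ hσ => ?_) hqj)
  · have := Nat.mul_ne_zero hd hk
    omega
  · have h1 := hG' σ hσ
    rw [map_mul, hAG hg'A σ hσ] at h1
    exact mul_left_cancel₀ hg'0 h1

/-! ### Power sums over a frame of row vectors -/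

/-- The linear form `v ⬝ x`. -/
noncomputable def linForm (v : Fin 2 → ℂ) : MvPolynomial (Fin 2) ℂ := ∑ j, C (v j) * X j

theorem eval_linForm (v x : Fin 2 → ℂ) : eval x (linForm v) = v ⬝ᵥ x := by
  simp [linForm, dotProduct]

theorem linForm_smul (c : ℂ) (v : Fin 2 → ℂ) : linForm (c • v) = C c * linForm v := by
  simp [linForm, mul_assoc, mul_add]

theorem isHomogeneous_linForm (v : Fin 2 → ℂ) : (linForm v).IsHomogeneous 1 :=
  IsHomogeneous.sum _ _ _ fun _ _ => isHomogeneous_C_mul_X _ _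

theorem act_linForm (σ : GL (Fin 2) ℂ) (v : Fin 2 → ℂ) :
    act σ (linForm v) = linForm (Matrix.vecMul v σ.val) := by
  refine MvPolynomial.funext fun x => ?_
  rw [eval_act, eval_linForm, eval_linForm, Matrix.dotProduct_mulVec]

theorem vecMul_one_zero (M : Matrix (Fin 2) (Fin 2) ℂ) : Matrix.vecMul ![1, 0] M = M 0 := by
  funext j
  simp [Matrix.vecMul, dotProduct]

theorem rowForm_zero (σ : GL (Fin 2) ℂ) :
    rowForm σ 0 = linForm (Matrix.vecMul ![1, 0] σ.val) := by
  rw [vecMul_one_zero]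
  rfl

theorem linForm_pow_eq {d n : ℕ} (hn : d ∣ n) {c : ℂ} (hc : c ^ d = 1) {v w : Fin 2 → ℂ}
    (h : v = c • w) : linForm v ^ n = linForm w ^ n := by
  obtain ⟨k, rfl⟩ := hn
  rw [h, linForm_smul, mul_pow, ← C_pow, pow_mul c, hc, one_pow, C_1, one_mul]

variable {κ : Type*} [Fintype κ]

/-- Up to `d`-th roots of unity, `σ` maps the row vectors `w i` to each other. -/
def MapsFrame (w : κ → Fin 2 → ℂ) (d : ℕ) (σ : GL (Fin 2) ℂ) : Prop :=
  ∀ i, ∃ j, ∃ c : ℂ, c ^ d = 1 ∧ Matrix.vecMul (w i) σ.val = c • w j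

/-- The power sum `∑ i, (w i ⬝ x) ^ n`. -/
noncomputable def frameSum (w : κ → Fin 2 → ℂ) (n : ℕ) : MvPolynomial (Fin 2) ℂ :=
  ∑ i, linForm (w i) ^ n

theorem isHomogeneous_frameSum (w : κ → Fin 2 → ℂ) (n : ℕ) : (frameSum w n).IsHomogeneous n :=
  IsHomogeneous.sum _ _ _ fun i _ => by simpa using (isHomogeneous_linForm (w i)).pow n

theorem eval_frameSum (w : κ → Fin 2 → ℂ) (n : ℕ) (x : Fin 2 → ℂ) :
    eval x (frameSum w n) = ∑ i, (w i ⬝ᵥ x) ^ n := by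
  simp [frameSum, eval_linForm]

theorem ne_zero_of_pow_eq_one {d : ℕ} (hd : d ≠ 0) {c : ℂ} (hc : c ^ d = 1) : c ≠ 0 := by
  rintro rfl
  rw [zero_pow hd] at hc
  exact zero_ne_one hc

/-- Two rows with proportional images would be proportional, since σ is invertible; an injection of
a finite set is bijective. -/
theorem MapsFrame.exists_perm {w : κ → Fin 2 → ℂ} {d : ℕ} (hd : d ≠ 0)
    (hw : ∀ i j, i ≠ j → ∀ c : ℂ, w i ≠ c • w j) {σ : GL (Fin 2) ℂ} (hσ : MapsFrame w d σ) :
    ∃ π : Equiv.Perm κ, ∀ i, ∃ c : ℂ, c ^ d = 1 ∧ Matrix.vecMul (w i) σ.val = c • w (π i) := by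
  choose π hπ using hσ
  have hinj : Function.Injective π := by
    intro i j hij
    by_contra hne
    obtain ⟨c, hc, h1⟩ := hπ i
    obtain ⟨c', hc', h2⟩ := hπ j
    have hc0 := ne_zero_of_pow_eq_one hd hc'
    refine hw i j hne (c * c'⁻¹) ?_
    apply Matrix.vecMul_injective_of_isUnit σ.isUnit
    simp only [Matrix.smul_vecMul]
    rw [h1, h2, hij, smul_smul, mul_assoc, inv_mul_cancel₀ hc0, mul_one]
  exact ⟨Equiv.ofBijective π (Finite.injective_iff_bijective.mp hinj), hπ⟩

theorem mapsFrame_of_mem_closure {w : κ → Fin 2 → ℂ} {d : ℕ} (hd : d ≠ 0)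
    (hw : ∀ i j, i ≠ j → ∀ c : ℂ, w i ≠ c • w j) {S : Set (GL (Fin 2) ℂ)}
    (hS : ∀ σ ∈ S, MapsFrame w d σ) {σ : GL (Fin 2) ℂ} (hσ : σ ∈ Subgroup.closure S) :
    MapsFrame w d σ := by
  induction hσ using Subgroup.closure_induction with
  | mem x hx => exact hS x hx
  | one => exact fun i => ⟨i, 1, one_pow d, by simp⟩
  | mul x y _ _ hx hy =>
    intro i
    obtain ⟨j, c, hc, h1⟩ := hx i
    obtain ⟨l, c', hc', h2⟩ := hy j
    refine ⟨l, c * c', by rw [mul_pow, hc, hc', one_mul], ?_⟩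
    rw [Units.val_mul, ← Matrix.vecMul_vecMul, h1, Matrix.smul_vecMul, h2, smul_smul]
  | inv x _ hx =>
    intro i
    obtain ⟨π, hπ⟩ := hx.exists_perm hd hw
    obtain ⟨c, hc, h1⟩ := hπ (π.symm i)
    refine ⟨π.symm i, c⁻¹, by rw [inv_pow, hc, inv_one], ?_⟩
    rw [Equiv.apply_symm_apply] at h1
    have h2 : w i = c⁻¹ • Matrix.vecMul (w (π.symm i)) x.val := by
      rw [h1, smul_smul, inv_mul_cancel₀ (ne_zero_of_pow_eq_one hd hc), one_smul]
    rw [h2, Matrix.smul_vecMul, Matrix.vecMul_vecMul, Units.mul_inv, Matrix.vecMul_one]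

theorem act_frameSum {w : κ → Fin 2 → ℂ} {d : ℕ} (hd : d ≠ 0)
    (hw : ∀ i j, i ≠ j → ∀ c : ℂ, w i ≠ c • w j) {σ : GL (Fin 2) ℂ} (hσ : MapsFrame w d σ)
    {n : ℕ} (hn : d ∣ n) : act σ (frameSum w n) = frameSum w n := by
  obtain ⟨π, hπ⟩ := hσ.exists_perm hd hw
  rw [frameSum, map_sum]
  refine Eq.trans ?_ (Equiv.sum_comp π _)
  refine Finset.sum_congr rfl fun i _ => ?_
  obtain ⟨c, hc, h⟩ := hπ i
  rw [map_pow, act_linForm, linForm_pow_eq hn hc h]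

/-- The rows w_{i₀} = (1, 0) and w_{i₁} form a basis, so σ is determined by their images, which lie
among the finitely many multiples of the w_j by d-th roots of unity. -/
theorem finite_of_mapsFrame {w : κ → Fin 2 → ℂ} {d : ℕ} (hd : d ≠ 0) {i₀ i₁ : κ}
    (h₀ : w i₀ = ![1, 0]) (h₁ : w i₁ 1 ≠ 0) {G : Subgroup (GL (Fin 2) ℂ)}
    (hG : ∀ σ ∈ G, MapsFrame w d σ) : Finite G := by
  set T : Set (Fin 2 → ℂ) := Set.image2 (fun (c : ℂ) j => c • w j)
    (Polynomial.nthRootsFinset d (1 : ℂ)) Set.univ with hT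
  have hTfin : T.Finite := Set.Finite.image2 _ (Finset.finite_toSet _) Set.finite_univ
  have := hTfin.to_subtype
  let F : G → κ → T := fun σ i => ⟨Matrix.vecMul (w i) σ.val.val, by
    obtain ⟨j, c, hc, h⟩ := hG σ.1 σ.2 i
    exact ⟨c, by simpa [Polynomial.mem_nthRootsFinset (Nat.pos_of_ne_zero hd)] using hc, j,
      trivial, h.symm⟩⟩
  refine Finite.of_injective F fun σ τ hστ => ?_
  have hrow : ∀ i, Matrix.vecMul (w i) σ.val.val = Matrix.vecMul (w i) τ.val.val := fun i =>
    congrArg Subtype.val (congrFun hστ i)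
  have hr0 := hrow i₀
  rw [h₀, vecMul_one_zero, vecMul_one_zero] at hr0
  have hr1 : σ.val.val 1 = τ.val.val 1 := by
    funext j
    have h := congrFun (hrow i₁) j
    simp only [Matrix.vecMul, dotProduct, Fin.sum_univ_two, hr0] at h
    exact mul_left_cancel₀ h₁ (add_left_cancel h)
  apply Subtype.ext
  apply Units.ext
  funext i
  fin_cases i
  · exact hr0
  · exact hr1

/-- The sum over G of the translates of `frameSum w n` is computed twice. Invariance gives |G| times
the frame sum. Since each w_i lies in the orbit of (1, 0) up to a root of unity, translating G shows
that each i contributes the sum of all (σ₁ x)^n. -/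
theorem ePoly_eq {w : κ → Fin 2 → ℂ} {d : ℕ} (hd : d ≠ 0)
    (hw : ∀ i j, i ≠ j → ∀ c : ℂ, w i ≠ c • w j)
    [Nonempty κ] {G : Subgroup (GL (Fin 2) ℂ)} [Finite G]
    (hG : ∀ σ ∈ G, MapsFrame w d σ)
    (hτ : ∀ i, ∃ τ ∈ G, ∃ c : ℂ, c ^ d = 1 ∧ Matrix.vecMul ![1, 0] τ.val = c • w i)
    {n : ℕ} (hn : d ∣ n) :
    ePoly G n = C ((Fintype.card κ : ℂ)⁻¹) * frameSum w n := by
  have := Fintype.ofFinite G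
  have hκ : (Fintype.card κ : ℂ) ≠ 0 := by exact_mod_cast Fintype.card_ne_zero
  have hcard : (Fintype.card G : ℂ) ≠ 0 := by exact_mod_cast Fintype.card_ne_zero
  have h1 : ∑ σ : G, act σ.1 (frameSum w n) = C (Fintype.card G : ℂ) * frameSum w n := by
    rw [Finset.sum_congr rfl fun (σ : G) _ => act_frameSum hd hw (hG σ.1 σ.2) hn,
      Finset.sum_const, Finset.card_univ, nsmul_eq_mul, map_natCast]
  have h2 : ∀ i, ∑ σ : G, act σ.1 (linForm (w i) ^ n) = ∑ σ : G, rowForm σ.1 0 ^ n := by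
    intro i
    obtain ⟨τ, hτG, c, hc, h⟩ := hτ i
    refine Eq.trans ?_ (Equiv.sum_comp (Equiv.mulLeft (⟨τ, hτG⟩ : G))
      fun σ => rowForm σ.1 0 ^ n)
    refine Finset.sum_congr rfl fun σ _ => ?_
    rw [← linForm_pow_eq hn hc h, map_pow, act_linForm, rowForm_zero, Matrix.vecMul_vecMul]
    rfl
  have h3 : ∑ σ : G, act σ.1 (frameSum w n) =
      C (Fintype.card κ : ℂ) * ∑ σ : G, rowForm σ.1 0 ^ n := by
    simp only [frameSum]
    rw [Finset.sum_congr rfl fun (σ : G) _ => map_sum (act σ.1) (fun i => linForm (w i) ^ n) _,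
      Finset.sum_comm, Finset.sum_congr rfl fun i _ => h2 i,
      Finset.sum_const, Finset.card_univ, nsmul_eq_mul, map_natCast]
  have h4 : ∑ σ : G, rowForm σ.1 0 ^ n =
      C ((Fintype.card κ : ℂ)⁻¹ * (Fintype.card G : ℂ)) * frameSum w n := by
    rw [C_mul, mul_assoc, ← h1, h3, ← mul_assoc, ← C_mul, inv_mul_cancel₀ hκ, C_1, one_mul]
  rw [ePoly, finsum_eq_sum_of_fintype, h4, ← mul_assoc, ← C_mul, Nat.card_eq_fintype_card]
  congr 2
  field_simp

/-! ### Groups generated by A and diag(1, z) -/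

theorem matB_pow (z : ℂ) (n : ℕ) : matB z ^ n = matB (z ^ n) := by
  induction n with
  | zero => simp [matB, Matrix.one_fin_two]
  | succ n ih => rw [pow_succ, ih, pow_succ]; simp [matB]

/-- A group generated by `A` and `diag(1, z)` whose orbit of `(1, 0)` consists of the multiples of
the rows `w i` by `d`-th roots of unity has its invariant ring generated by two E-polynomials. -/
theorem invariantRing_eq_adjoin_ePoly {A : Matrix (Fin 2) (Fin 2) ℂ} (hA : A.det ≠ 0) {z : ℂ}
    (hz : (matB z).det ≠ 0) {G : Subgroup (GL (Fin 2) ℂ)}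
    (hG : G = Subgroup.closure {Matrix.GeneralLinearGroup.mkOfDetNeZero A hA,
      Matrix.GeneralLinearGroup.mkOfDetNeZero (matB z) hz})
    {d k m r : ℕ} (hd : d ≠ 0) (hk : k ≠ 0) (hm : m = d * k)
    {ζ : ℂ} (hζ : IsPrimitiveRoot ζ d) {l : ℕ} (hl : (A * matB z) ^ l = ζ • 1)
    (hzr : IsPrimitiveRoot z r) (hr : Fintype.card κ * r = m)
    {w : κ → Fin 2 → ℂ} (hw : ∀ i j, i ≠ j → ∀ c : ℂ, w i ≠ c • w j)
    {i₀ i₁ : κ} (h₀ : w i₀ = ![1, 0]) (h₁ : w i₁ 1 ≠ 0)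
    (hwA : ∀ i, ∃ j, ∃ c : ℂ, c ^ d = 1 ∧ Matrix.vecMul (w i) A = c • w j)
    (hwB : ∀ i, ∃ j, ∃ c : ℂ, c ^ d = 1 ∧ Matrix.vecMul (w i) (matB z) = c • w j)
    (hτ : ∀ i, ∃ τ ∈ G, ∃ c : ℂ, c ^ d = 1 ∧ Matrix.vecMul ![1, 0] τ.val = c • w i)
    {x y : Fin 2 → ℂ} (hx : ∑ i, (w i ⬝ᵥ x) ^ d ≠ 0)
    (hxy : (∑ i, (w i ⬝ᵥ x) ^ m) * (∑ i, (w i ⬝ᵥ y) ^ d) ^ k ≠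
      (∑ i, (w i ⬝ᵥ y) ^ m) * (∑ i, (w i ⬝ᵥ x) ^ d) ^ k) :
    Finite G ∧ invariantRing G = Algebra.adjoin ℂ {ePoly G d, ePoly G m} ∧
      AlgebraicIndependent ℂ ![ePoly G d, ePoly G m] := by
  subst hm
  set a := Matrix.GeneralLinearGroup.mkOfDetNeZero A hA with ha
  set b := Matrix.GeneralLinearGroup.mkOfDetNeZero (matB z) hz with hb
  have haG : a ∈ G := hG ▸ Subgroup.subset_closure (by simp)
  have hbG : b ∈ G := hG ▸ Subgroup.subset_closure (by simp)
  have hmaps : ∀ σ ∈ G, MapsFrame w d σ := fun σ hσ =>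
    mapsFrame_of_mem_closure hd hw (by rintro σ (rfl | rfl) <;> assumption) (hG ▸ hσ)
  have hfin : Finite G := finite_of_mapsFrame hd h₀ h₁ hmaps
  have : Nonempty κ := ⟨i₀⟩
  have hκ : (Fintype.card κ : ℂ)⁻¹ ≠ 0 := inv_ne_zero (by exact_mod_cast Fintype.card_ne_zero)
  have he : ∀ n, d ∣ n → ePoly G n = C ((Fintype.card κ : ℂ)⁻¹) * frameSum w n := fun n hn =>
    ePoly_eq hd hw hmaps hτ hn
  have hhom : ∀ n, d ∣ n → (ePoly G n).IsHomogeneous n := fun n hn =>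
    he n hn ▸ (isHomogeneous_frameSum w n).C_mul _
  have hinv : ∀ n, d ∣ n → ePoly G n ∈ invariantRing G := fun n hn => he n hn ▸
    C_mul_mem _ (fun σ hσ => act_frameSum hd hw (hmaps σ hσ) hn)
  have heval : ∀ n, d ∣ n → ∀ u, eval u (ePoly G n) =
      (Fintype.card κ : ℂ)⁻¹ * ∑ i, (w i ⬝ᵥ u) ^ n := fun n hn u => by
    rw [he n hn, map_mul, eval_C, eval_frameSum]
  have hdd : d ∣ d := dvd_rfl
  have hdk : d ∣ d * k := dvd_mul_right d k
  choose τ hτG c hc hτw using hτ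
  have hbpow : ∀ t : ℕ, (b ^ t).val = matB (z ^ t) := fun t => by
    rw [Units.val_pow_eq_pow_val, ← matB_pow]; rfl
  -- The elements b^t τ_i with t < r serve as ρ. Their first row is a multiple of w_i, which
  -- recovers i modulo scalars; cancelling τ_i then leaves diag(1, z^t), which recovers t.
  refine ⟨hfin, invariantRing_eq_adjoin (ι := κ × Fin r) hd hζ (s := (a * b) ^ l)
    (pow_mem (mul_mem haG hbG) l) hl hk (hhom d hdd) (hhom _ hdk) (hinv d hdd) (hinv _ hdk)
    ?_ ?_ (by simpa using hr) (ρ := fun it => b ^ (it.2 : ℕ) * τ it.1)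
    (fun it => mul_mem (pow_mem hbG _) (hτG _)) ?_⟩
  · intro h0
    have h1 := heval d hdd x
    rw [h0, map_zero] at h1
    exact mul_ne_zero hκ hx h1.symm
  -- If φ_{dk} = e φ_d^k, both sides of `hxy` are the same product up to order.
  · intro e h
    apply hxy
    have h1 : ∀ u, ∑ i, (w i ⬝ᵥ u) ^ (d * k) = (Fintype.card κ : ℂ) *
        (e * ((Fintype.card κ : ℂ)⁻¹ * ∑ i, (w i ⬝ᵥ u) ^ d) ^ k) := fun u => by
      have h2 := heval _ hdk u
      rw [h, map_mul, map_pow, eval_C, heval d hdd] at h2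
      rw [h2, ← mul_assoc, mul_inv_cancel₀ (fun h0 => hκ (by rw [h0, inv_zero])), one_mul]
    rw [h1, h1, mul_pow, mul_pow]
    ring
  · rintro ⟨i, t⟩ ⟨i', t'⟩ hne e h
    simp only [Units.val_mul, hbpow] at h
    have hrow : ∀ (j : κ) (q : ℂ), Matrix.vecMul ![1, 0] (matB q * (τ j).val) = c j • w j := by
      intro j q
      rw [← Matrix.vecMul_vecMul, vecMul_one_zero, ← hτw]
      congr 1
    have h1 := congrArg (Matrix.vecMul ![1, 0]) h
    rw [Matrix.vecMul_smul, hrow, hrow, smul_smul] at h1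
    have hci : c i ≠ 0 := ne_zero_of_pow_eq_one hd (hc i)
    have hii : i = i' := by
      by_contra hii
      refine hw i i' hii ((c i)⁻¹ * (e * c i')) ?_
      rw [← smul_smul, ← h1, smul_smul, inv_mul_cancel₀ hci, one_smul]
    subst hii
    have hu : IsUnit (τ i).val := (τ i).isUnit
    have h3 : matB (z ^ (t : ℕ)) = e • matB (z ^ (t' : ℕ)) := by
      rw [← Matrix.smul_mul] at h
      exact hu.mul_right_cancel h
    have h4 := congrFun (congrFun h3 0) 0
    have h5 := congrFun (congrFun h3 1) 1
    simp only [matB, Matrix.smul_apply, Matrix.of_apply, Matrix.cons_val_zero,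
      Matrix.cons_val_one, smul_eq_mul, mul_one] at h4 h5
    rw [← h4, one_mul] at h5
    exact hne (Prod.ext rfl (Fin.ext (hzr.pow_inj t.2 t'.2 h5)))

/-! ### The four groups -/

theorem vecMul_eq_smul {v w : Fin 2 → ℂ} {M : Matrix (Fin 2) (Fin 2) ℂ} {c : ℂ}
    (h₀ : v 0 * M 0 0 + v 1 * M 1 0 = c * w 0) (h₁ : v 0 * M 0 1 + v 1 * M 1 1 = c * w 1) :
    Matrix.vecMul v M = c • w := by
  funext j
  fin_cases j
  · simpa [Matrix.vecMul, dotProduct] using h₀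
  · simpa [Matrix.vecMul, dotProduct] using h₁

theorem ne_smul_of_lt {κ : Type*} [LinearOrder κ] {w : κ → Fin 2 → ℂ}
    (h : ∀ i j, i < j → w i 0 * w j 1 ≠ w i 1 * w j 0) {i j : κ} (hij : i ≠ j) (c : ℂ) :
    w i ≠ c • w j := by
  intro hc
  have h0 : w i 0 = c * w j 0 := congrFun hc 0
  have h1 : w i 1 = c * w j 1 := congrFun hc 1
  rcases lt_or_gt_of_ne hij with hlt | hlt
  · exact h i j hlt (by rw [h0, h1]; ring)
  · exact h j i hlt (by rw [h0, h1]; ring)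

theorem inv_sqrt_sq {n : ℕ} : (((Real.sqrt n : ℝ) : ℂ)⁻¹) ^ 2 = (n : ℂ)⁻¹ := by
  rw [inv_pow, ← Complex.ofReal_pow, Real.sq_sqrt (Nat.cast_nonneg n), Complex.ofReal_natCast]

theorem isPrimitiveRoot_two_pow {ζ : ℂ} {n : ℕ} (h : ζ ^ 2 ^ n = -1) :
    IsPrimitiveRoot ζ (2 ^ (n + 1)) := by
  rw [IsPrimitiveRoot.iff_orderOf]
  refine orderOf_eq_prime_pow ?_ (by rw [pow_succ, pow_mul, h]; norm_num)
  rw [h]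
  norm_num

theorem invariantRing_GIV :
    Finite GIV ∧ invariantRing GIV = Algebra.adjoin ℂ {ePoly GIV 2, ePoly GIV 6} ∧
      AlgebraicIndependent ℂ ![ePoly GIV 2, ePoly GIV 6] := by
  have hζ : IsPrimitiveRoot (-1 : ℂ) 2 := IsPrimitiveRoot.neg_one 0 (by norm_num)
  have ha : Matrix.GeneralLinearGroup.mkOfDetNeZero matA4 det_matA4_ne_zero ∈ GIV :=
    Subgroup.subset_closure (by simp)
  have hb : Matrix.GeneralLinearGroup.mkOfDetNeZero (matB (-1))
      (det_matB_ne_zero (neg_ne_zero.mpr one_ne_zero)) ∈ GIV :=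
    Subgroup.subset_closure (by simp)
  refine invariantRing_eq_adjoin_ePoly (d := 2) (k := 3) (r := 2) (l := 3) (ζ := -1)
    (w := ![![1, 0], ![1 / 2, 3 / 2], ![1 / 2, -3 / 2]]) (i₀ := 0) (i₁ := 1)
    (x := ![1, 0]) (y := ![0, 1])
    det_matA4_ne_zero (det_matB_ne_zero (neg_ne_zero.mpr one_ne_zero)) rfl two_ne_zero
    three_ne_zero rfl hζ ?_ hζ rfl (fun i j => ne_smul_of_lt ?_) rfl (by simp) ?_ ?_ ?_ ?_ ?_
  · ext i j
    fin_cases i <;> fin_cases j <;>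
      simp [matA4, matB, pow_succ, Matrix.mul_apply] <;> norm_num
  · intro i j hij
    fin_cases i <;> fin_cases j <;> simp at hij <;> simp
    norm_num
  · intro i
    fin_cases i
    · exact ⟨1, 1, by norm_num, vecMul_eq_smul (by simp [matA4]) (by simp [matA4]; grind)⟩
    · exact ⟨0, 1, by norm_num,
        vecMul_eq_smul (by simp [matA4]; grind) (by simp [matA4]; grind)⟩
    · exact ⟨2, -1, by norm_num,
        vecMul_eq_smul (by simp [matA4]; grind) (by simp [matA4]; grind)⟩
  · intro i
    fin_cases i
    · exact ⟨0, 1, by norm_num, vecMul_eq_smul (by simp [matB]) (by simp [matB])⟩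
    · exact ⟨2, 1, by norm_num, vecMul_eq_smul (by simp [matB]) (by simp [matB]; grind)⟩
    · exact ⟨1, 1, by norm_num, vecMul_eq_smul (by simp [matB]) (by simp [matB]; grind)⟩
  · intro i
    fin_cases i
    · exact ⟨1, one_mem _, 1, by norm_num, by simp⟩
    · exact ⟨_, ha, 1, by norm_num, vecMul_eq_smul (by simp [matA4])
        (by simp [matA4]; grind)⟩
    · exact ⟨_, mul_mem ha hb, 1, by norm_num,
        vecMul_eq_smul (by simp [matA4, matB])
        (by simp [matA4, matB]; grind)⟩
  · simp [Fin.sum_univ_succ]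
    norm_num
  · simp [Fin.sum_univ_succ]
    norm_num

theorem invariantRing_GI :
    Finite GI ∧ invariantRing GI = Algebra.adjoin ℂ {ePoly GI 2, ePoly GI 8} ∧
      AlgebraicIndependent ℂ ![ePoly GI 2, ePoly GI 8] := by
  have hζ : IsPrimitiveRoot (-1 : ℂ) 2 := IsPrimitiveRoot.neg_one 0 (by norm_num)
  have ha : Matrix.GeneralLinearGroup.mkOfDetNeZero matA2 det_matA2_ne_zero ∈ GI :=
    Subgroup.subset_closure (by simp)
  have hb : Matrix.GeneralLinearGroup.mkOfDetNeZero (matB (-1))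
      (det_matB_ne_zero (neg_ne_zero.mpr one_ne_zero)) ∈ GI :=
    Subgroup.subset_closure (by simp)
  -- Only u² = 1/2 is used from here on, so the checks are polynomial identities.
  obtain ⟨u, hu, hA⟩ : ∃ u : ℂ, u ^ 2 = 2⁻¹ ∧ matA2 = u • !![1, 1; 1, -1] :=
    ⟨_, by simpa using inv_sqrt_sq (n := 2), rfl⟩
  have hu0 : u ≠ 0 := by rintro rfl; norm_num at hu
  -- The point y = (0, 1) would not do: A diag(1, -1) A swaps the coordinates, so invariants agree
  -- at (1, 0) and (0, 1).
  refine invariantRing_eq_adjoin_ePoly (d := 2) (k := 4) (r := 2) (l := 4) (ζ := -1)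
    (w := ![![1, 0], ![0, 1], ![u, u], ![u, -u]]) (i₀ := 0) (i₁ := 1)
    (x := ![1, 0]) (y := ![1, 2])
    det_matA2_ne_zero (det_matB_ne_zero (neg_ne_zero.mpr one_ne_zero)) rfl two_ne_zero
    four_ne_zero rfl hζ ?_ hζ rfl (fun i j => ne_smul_of_lt ?_) rfl (by simp) ?_ ?_ ?_ ?_ ?_
  · ext i j
    fin_cases i <;> fin_cases j <;>
      simp [hA, matB, pow_succ, Matrix.mul_apply] <;> grind
  · intro i j hij
    fin_cases i <;> fin_cases j <;> simp at hij <;> simp <;> grind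
  · intro i
    fin_cases i
    · exact ⟨2, 1, by norm_num, vecMul_eq_smul (by simp [hA]) (by simp [hA])⟩
    · exact ⟨3, 1, by norm_num, vecMul_eq_smul (by simp [hA]) (by simp [hA])⟩
    · exact ⟨0, 1, by norm_num, vecMul_eq_smul (by simp [hA]; grind) (by simp [hA])⟩
    · exact ⟨1, 1, by norm_num, vecMul_eq_smul (by simp [hA]) (by simp [hA]; grind)⟩
  · intro i
    fin_cases i
    · exact ⟨0, 1, by norm_num, vecMul_eq_smul (by simp [matB]) (by simp [matB])⟩
    · exact ⟨1, -1, by norm_num, vecMul_eq_smul (by simp [matB]) (by simp [matB])⟩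
    · exact ⟨3, 1, by norm_num, vecMul_eq_smul (by simp [matB]) (by simp [matB])⟩
    · exact ⟨2, 1, by norm_num, vecMul_eq_smul (by simp [matB]) (by simp [matB])⟩
  · intro i
    fin_cases i
    · exact ⟨1, one_mem _, 1, by norm_num, by simp⟩
    · exact ⟨_, mul_mem (mul_mem ha hb) ha, 1, by norm_num,
        vecMul_eq_smul (by simp [hA, matB]) (by simp [hA, matB]; grind)⟩
    · exact ⟨_, ha, 1, by norm_num, vecMul_eq_smul (by simp [hA]) (by simp [hA])⟩
    · exact ⟨_, mul_mem ha hb, 1, by norm_num,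
        vecMul_eq_smul (by simp [hA, matB]) (by simp [hA, matB])⟩
  · simp [Fin.sum_univ_succ, hu]
    norm_num
  · have h8 : u ^ 8 = 1 / 16 := by rw [show u ^ 8 = (u ^ 2) ^ 4 by ring, hu]; norm_num
    have f1 : u + u * 2 = u * 3 := by ring
    have f2 : u + -(u * 2) = -u := by ring
    simp [Fin.sum_univ_succ, f1, f2, mul_pow, hu, h8]
    norm_num [h8]

set_option maxHeartbeats 1000000 in
theorem invariantRing_GII :
    Finite GII ∧ invariantRing GII = Algebra.adjoin ℂ {ePoly GII 8, ePoly GII 24} ∧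
      AlgebraicIndependent ℂ ![ePoly GII 8, ePoly GII 24] := by
  have ha : Matrix.GeneralLinearGroup.mkOfDetNeZero matA2 det_matA2_ne_zero ∈ GII :=
    Subgroup.subset_closure (by simp)
  have hb : Matrix.GeneralLinearGroup.mkOfDetNeZero (matB Complex.I)
      (det_matB_ne_zero Complex.I_ne_zero) ∈ GII :=
    Subgroup.subset_closure (by simp)
  obtain ⟨u, hu, hA⟩ : ∃ u : ℂ, u ^ 2 = 2⁻¹ ∧ matA2 = u • !![1, 1; 1, -1] :=
    ⟨_, by simpa using inv_sqrt_sq (n := 2), rfl⟩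
  have hu0 : u ≠ 0 := by rintro rfl; norm_num at hu
  have hI := Complex.I_sq
  have h8 : u ^ 8 = 1 / 16 := by rw [show u ^ 8 = (u ^ 2) ^ 4 by ring, hu]; norm_num
  have hζ4 : (u * (1 + Complex.I)) ^ 4 = -1 := by grind
  have hζ4' : (u * (1 - Complex.I)) ^ 4 = -1 := by grind
  have hζ : IsPrimitiveRoot (u * (1 + Complex.I)) 8 := isPrimitiveRoot_two_pow (n := 2) hζ4
  have hζ8' : (u * (1 - Complex.I)) ^ 8 = 1 := by rw [pow_mul _ 4 2, hζ4']; norm_num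
  refine invariantRing_eq_adjoin_ePoly (d := 8) (k := 3) (r := 4) (l := 3)
    (ζ := u * (1 + Complex.I))
    (w := ![![1, 0], ![0, 1], ![u, u], ![u, u * Complex.I], ![u, -u], ![u, -(u * Complex.I)]])
    (i₀ := 0) (i₁ := 1) (x := ![1, 0]) (y := ![1, 2])
    det_matA2_ne_zero (det_matB_ne_zero Complex.I_ne_zero) rfl (by norm_num)
    three_ne_zero rfl hζ ?_ (isPrimitiveRoot_two_pow (n := 1) (by simp)) rfl
    (fun i j => ne_smul_of_lt ?_) rfl (by simp) ?_ ?_ ?_ ?_ ?_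
  · ext i j
    fin_cases i <;> fin_cases j <;>
      simp [hA, matB, pow_succ, Matrix.mul_apply] <;> grind
  · intro i j hij
    fin_cases i <;> fin_cases j <;> simp at hij <;> simp <;> grind
  · intro i
    fin_cases i
    · exact ⟨2, 1, by norm_num, vecMul_eq_smul (by simp [hA]) (by simp [hA])⟩
    · exact ⟨4, 1, by norm_num, vecMul_eq_smul (by simp [hA]) (by simp [hA])⟩
    · exact ⟨0, 1, by norm_num, vecMul_eq_smul (by simp [hA]; grind) (by simp [hA])⟩
    · exact ⟨5, _, hζ.pow_eq_one, vecMul_eq_smul (by simp [hA]; grind) (by simp [hA]; grind)⟩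
    · exact ⟨1, 1, by norm_num, vecMul_eq_smul (by simp [hA]) (by simp [hA]; grind)⟩
    -- Here the root of unity is u(1 - i), the conjugate choice to ζ = u(1 + i).
    · exact ⟨3, _, hζ8', vecMul_eq_smul (by simp [hA]; grind) (by simp [hA]; grind)⟩
  · intro i
    fin_cases i
    · exact ⟨0, 1, by norm_num, vecMul_eq_smul (by simp [matB]) (by simp [matB])⟩
    · exact ⟨1, Complex.I, by grind, vecMul_eq_smul (by simp [matB]) (by simp [matB])⟩
    · exact ⟨3, 1, by norm_num, vecMul_eq_smul (by simp [matB]) (by simp [matB])⟩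
    · exact ⟨4, 1, by norm_num, vecMul_eq_smul (by simp [matB]) (by simp [matB]; grind)⟩
    · exact ⟨5, 1, by norm_num, vecMul_eq_smul (by simp [matB]) (by simp [matB])⟩
    · exact ⟨2, 1, by norm_num, vecMul_eq_smul (by simp [matB]) (by simp [matB]; grind)⟩
  · intro i
    fin_cases i
    · exact ⟨1, one_mem _, 1, by norm_num, by simp⟩
    · exact ⟨_, mul_mem (mul_mem (mul_mem ha hb) hb) ha, 1, by norm_num,
        vecMul_eq_smul (by simp [hA, matB]; grind) (by simp [hA, matB]; grind)⟩
    · exact ⟨_, ha, 1, by norm_num, vecMul_eq_smul (by simp [hA]) (by simp [hA])⟩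
    · exact ⟨_, mul_mem ha hb, 1, by norm_num,
        vecMul_eq_smul (by simp [hA, matB]) (by simp [hA, matB])⟩
    · exact ⟨_, mul_mem (mul_mem ha hb) hb, 1, by norm_num,
        vecMul_eq_smul (by simp [hA, matB]) (by simp [hA, matB]; grind)⟩
    · exact ⟨_, mul_mem (mul_mem (mul_mem ha hb) hb) hb, 1, by norm_num,
        vecMul_eq_smul (by simp [hA, matB]) (by simp [hA, matB]; grind)⟩
  · simp [Fin.sum_univ_succ, h8]
    norm_num
  · have e1 : (1 + 2 * Complex.I) ^ 8 = -527 + 336 * Complex.I := by grind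
    have e2 : (1 - 2 * Complex.I) ^ 8 = -527 - 336 * Complex.I := by grind
    have e3 : ∀ v : ℂ, v ^ 24 = (v ^ 8) ^ 3 := fun v => by ring
    have f1 : u + u * 2 = u * 3 := by ring
    have f2 : u + u * Complex.I * 2 = u * (1 + 2 * Complex.I) := by ring
    have f3 : u + -(u * 2) = u * (-1) := by ring
    have f4 : u + -(u * Complex.I * 2) = u * (1 - 2 * Complex.I) := by ring
    simp [Fin.sum_univ_succ, f1, f2, f3, f4, mul_pow, e3, e1, e2, h8]
    grind

/-- The argument needs only 1 + ω + ω² = 0 and u² = 1/3, not the exponential form of ω. -/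
theorem invariantRing_of_isPrimitiveRoot_three {ω : ℂ} (hω : IsPrimitiveRoot ω 3)
    (hdet : (matB ω).det ≠ 0) {G : Subgroup (GL (Fin 2) ℂ)}
    (hG : G = Subgroup.closure
      {Matrix.GeneralLinearGroup.mkOfDetNeZero matA3 det_matA3_ne_zero,
        Matrix.GeneralLinearGroup.mkOfDetNeZero (matB ω) hdet}) :
    Finite G ∧ invariantRing G = Algebra.adjoin ℂ {ePoly G 4, ePoly G 12} ∧
      AlgebraicIndependent ℂ ![ePoly G 4, ePoly G 12] := by
  have ha : Matrix.GeneralLinearGroup.mkOfDetNeZero matA3 det_matA3_ne_zero ∈ G :=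
    hG ▸ Subgroup.subset_closure (by simp)
  have hb : Matrix.GeneralLinearGroup.mkOfDetNeZero (matB ω) hdet ∈ G :=
    hG ▸ Subgroup.subset_closure (by simp)
  obtain ⟨u, hu, hA⟩ : ∃ u : ℂ, u ^ 2 = 3⁻¹ ∧ matA3 = u • !![1, 2; 1, -1] :=
    ⟨_, by simpa using inv_sqrt_sq (n := 3), rfl⟩
  have hu0 : u ≠ 0 := by rintro rfl; norm_num at hu
  have hω3 : 1 + ω + ω ^ 2 = 0 := by
    simpa [Finset.sum_range_succ] using hω.geom_sum_eq_zero (by norm_num)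
  have hω1 : ω ≠ 1 := hω.ne_one (by norm_num)
  have hω0 : ω ≠ 0 := hω.ne_zero three_ne_zero
  have hζ2 : (u * (1 + 2 * ω)) ^ 2 = -1 := by grind
  have hζ2' : (u * (1 + 2 * ω ^ 2)) ^ 2 = -1 := by grind
  have hζ : IsPrimitiveRoot (u * (1 + 2 * ω)) 4 := isPrimitiveRoot_two_pow (n := 1) (by simpa)
  have hζ4' : (u * (1 + 2 * ω ^ 2)) ^ 4 = 1 := by rw [pow_mul _ 2 2, hζ2']; norm_num
  refine invariantRing_eq_adjoin_ePoly (d := 4) (k := 3) (r := 3) (l := 3)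
    (ζ := u * (1 + 2 * ω))
    (w := ![![1, 0], ![u, 2 * u], ![u, 2 * u * ω], ![u, 2 * u * ω ^ 2]])
    (i₀ := 0) (i₁ := 1) (x := ![1, 0]) (y := ![0, 1])
    det_matA3_ne_zero hdet hG four_ne_zero
    three_ne_zero rfl hζ ?_ hω rfl
    (fun i j => ne_smul_of_lt ?_) rfl (by simpa using hu0) ?_ ?_ ?_ ?_ ?_
  · ext i j
    fin_cases i <;> fin_cases j <;>
      simp [hA, matB, pow_succ, Matrix.mul_apply] <;> grind
  · intro i j hij
    fin_cases i <;> fin_cases j <;> simp at hij <;> simp <;> grind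
  · intro i
    fin_cases i
    · exact ⟨1, 1, by norm_num, vecMul_eq_smul (by simp [hA]) (by simp [hA]; grind)⟩
    · exact ⟨0, 1, by norm_num, vecMul_eq_smul (by simp [hA]; grind) (by simp [hA]; grind)⟩
    · exact ⟨3, _, hζ.pow_eq_one, vecMul_eq_smul (by simp [hA]; grind) (by simp [hA]; grind)⟩
    · exact ⟨2, _, hζ4', vecMul_eq_smul (by simp [hA]; grind) (by simp [hA]; grind)⟩
  · intro i
    fin_cases i
    · exact ⟨0, 1, by norm_num, vecMul_eq_smul (by simp [matB]) (by simp [matB])⟩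
    · exact ⟨2, 1, by norm_num, vecMul_eq_smul (by simp [matB]) (by simp [matB])⟩
    · exact ⟨3, 1, by norm_num, vecMul_eq_smul (by simp [matB]) (by simp [matB]; grind)⟩
    · exact ⟨1, 1, by norm_num, vecMul_eq_smul (by simp [matB]) (by simp [matB]; grind)⟩
  · intro i
    fin_cases i
    · exact ⟨1, one_mem _, 1, by norm_num, by simp⟩
    · exact ⟨_, ha, 1, by norm_num, vecMul_eq_smul (by simp [hA]) (by simp [hA]; grind)⟩
    · exact ⟨_, mul_mem ha hb, 1, by norm_num,
        vecMul_eq_smul (by simp [hA, matB]) (by simp [hA, matB]; grind)⟩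
    · exact ⟨_, mul_mem (mul_mem ha hb) hb, 1, by norm_num,
        vecMul_eq_smul (by simp [hA, matB]) (by simp [hA, matB]; grind)⟩
  · have h4 : u ^ 4 = 1 / 9 := by rw [show u ^ 4 = (u ^ 2) ^ 2 by ring, hu]; norm_num
    simp [Fin.sum_univ_succ, h4]
    norm_num
  -- At (0, 1) the sum of fourth powers is a multiple of 1 + ω + ω² = 0, while the sum of twelfth
  -- powers is not zero.
  · have h4 : u ^ 4 = 1 / 9 := by rw [show u ^ 4 = (u ^ 2) ^ 2 by ring, hu]; norm_num
    have h12 : u ^ 12 = 1 / 729 := by rw [show u ^ 12 = (u ^ 2) ^ 6 by ring, hu]; norm_num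
    have hω3 := hω.pow_eq_one
    have e1 : ω ^ 4 = ω := by rw [pow_succ, hω3, one_mul]
    have e2 : ω ^ 12 = 1 := by rw [pow_mul ω 3 4, hω3, one_pow]
    have e3 : (ω ^ 2) ^ 4 = ω ^ 2 := by rw [← pow_mul, pow_mul ω 4 2, e1]
    have e4 : (ω ^ 2) ^ 12 = 1 := by rw [← pow_mul, pow_mul ω 12 2, e2, one_pow]
    simp [Fin.sum_univ_succ, mul_pow, h4, h12, e1, e2, e3, e4]
    grind

theorem invariantRing_GIII :
    Finite GIII ∧ invariantRing GIII = Algebra.adjoin ℂ {ePoly GIII 4, ePoly GIII 12} ∧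
      AlgebraicIndependent ℂ ![ePoly GIII 4, ePoly GIII 12] :=
  invariantRing_of_isPrimitiveRoot_three
    (by simpa using Complex.isPrimitiveRoot_exp 3 three_ne_zero) _ rfl

end EPolynomial

theorem mainTheorem2 :
    (Finite EPolynomial.GI ∧
      EPolynomial.invariantRing EPolynomial.GI =
        Algebra.adjoin ℂ {EPolynomial.ePoly EPolynomial.GI 2,
          EPolynomial.ePoly EPolynomial.GI 8} ∧
      AlgebraicIndependent ℂ ![EPolynomial.ePoly EPolynomial.GI 2,
          EPolynomial.ePoly EPolynomial.GI 8]) ∧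
    (Finite EPolynomial.GII ∧
      EPolynomial.invariantRing EPolynomial.GII =
        Algebra.adjoin ℂ {EPolynomial.ePoly EPolynomial.GII 8,
          EPolynomial.ePoly EPolynomial.GII 24} ∧
      AlgebraicIndependent ℂ ![EPolynomial.ePoly EPolynomial.GII 8,
          EPolynomial.ePoly EPolynomial.GII 24]) ∧
    (Finite EPolynomial.GIII ∧
      EPolynomial.invariantRing EPolynomial.GIII =
        Algebra.adjoin ℂ {EPolynomial.ePoly EPolynomial.GIII 4,
          EPolynomial.ePoly EPolynomial.GIII 12} ∧
      AlgebraicIndependent ℂ ![EPolynomial.ePoly EPolynomial.GIII 4,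
          EPolynomial.ePoly EPolynomial.GIII 12]) ∧
    (Finite EPolynomial.GIV ∧
      EPolynomial.invariantRing EPolynomial.GIV =
        Algebra.adjoin ℂ {EPolynomial.ePoly EPolynomial.GIV 2,
          EPolynomial.ePoly EPolynomial.GIV 6} ∧
      AlgebraicIndependent ℂ ![EPolynomial.ePoly EPolynomial.GIV 2,
          EPolynomial.ePoly EPolynomial.GIV 6]) := by
  exact ⟨EPolynomial.invariantRing_GI, EPolynomial.invariantRing_GII,
    EPolynomial.invariantRing_GIII, EPolynomial.invariantRing_GIV⟩
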